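/- Graphs are finite and may have loops and parallel edges. A snark is a connected cubic graph (a loop counts twice in the degree) that has no proper edge-colouring with three colours; a graph with a loop has no proper edge-colouring. For distinct vertices $u,v$ of a graph $G$, let $G-\{u,v\}$ be obtained from $G$ by removing $u$ and $v$ while retaining, as dangling edges, the edges joining a removed vertex to a remaining one, and let $G/\{u,v\}$ be obtained from $G$ by identifying $u$ and $v$ (edges between $u$ and $v$ become loops). A snark $G$ is $k$-irreducible ($k\ge 1$) if there is no set of fewer than $k$ edges of $G$ whose removal leaves a component that is not $3$-edge-colourable and that can be completed, by adding edges and vertices, to a cubic graph with fewer vertices than $G$. Theorem. For every snark $G$ the following statements are equivalent: (i) $G$ is bicritical, that is, $G-\{u,v\}$ is $3$-edge-colourable for every two distinct vertices $u,v$ of $G$; (ii) $G$ is $4$-vertex-critical, that is, $G/\{u,v\}$ has a nowhere-zero $4$-flow for every two distinct vertices $u,v$ of $G$; (iii) $G$ is $7$-irreducible; (iv) $G$ is irreducible, that is, $k$-irreducible for every integer $k\ge 1$. -/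

import Mathlib

/-!
Graphs are finite undirected multigraphs, with loops and parallel edges allowed: `Graph α β` is a
graph with vertices in `α` and edges in `β`.
-/

namespace Graph

open Set

variable {α β : Type*}

/-- The degree of a vertex; a loop contributes 2. -/
noncomputable def vertexDegree (G : Graph α β) (x : α) : ℕ∞ :=
  (G.incidenceSet x).encard + (G.loopSet x).encard

/-- Every vertex has degree 3. -/
def IsCubic (G : Graph α β) : Prop := ∀ x ∈ G.vertexSet, G.vertexDegree x = 3

/-- A graph is connected if it has a vertex and any two vertices are joined by a walk. -/
def IsConnected (G : Graph α β) : Prop :=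
  G.vertexSet.Nonempty ∧
    ∀ x ∈ G.vertexSet, ∀ y ∈ G.vertexSet, Relation.ReflTransGen G.Adj x y

/-- `K` is a (connected) component of `G`: a nonempty connected subgraph that contains all the
edges of `G` incident with its vertices. -/
def IsComponentOf (K G : Graph α β) : Prop := K.IsClosedSubgraph G ∧ K.IsConnected

end Graph

/-- A graph which may have dangling edges. The ordinary edges (with two ends, possibly equal) are
those of the underlying `Graph`; in addition, `Dangling e x` says that `e` is a dangling edge whose
only end is the vertex `x`. -/
structure DanglingGraph (α β : Type*) extends Graph α β where
  Dangling : β → α → Prop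
  dangling_unique : ∀ ⦃e x y⦄, Dangling e x → Dangling e y → x = y
  dangling_not_edge : ∀ ⦃e x⦄, Dangling e x → e ∉ edgeSet
  dangling_mem : ∀ ⦃e x⦄, Dangling e x → x ∈ vertexSet

namespace DanglingGraph

variable {α β : Type*}

/-- `e` is an edge, ordinary or dangling, that has an end at `x`. -/
def Incident (M : DanglingGraph α β) (e : β) (x : α) : Prop :=
  M.toGraph.Inc e x ∨ M.Dangling e x

/-- `M` has a proper edge-colouring with `k` colours: edge ends that meet at a vertex have
different colours. In particular a graph with a loop has no such colouring, as the two ends of a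
loop meet. -/
def EdgeColourable (M : DanglingGraph α β) (k : ℕ) : Prop :=
  ∃ c : β → Fin k,
    (∀ e x, ¬ M.toGraph.IsLoopAt e x) ∧
    ∀ e f x, e ≠ f → M.Incident e x → M.Incident f x → c e ≠ c f

end DanglingGraph

namespace Graph

open Set

variable {α β : Type*}

/-- A graph, seen as a graph without dangling edges. -/
def toDanglingGraph (G : Graph α β) : DanglingGraph α β where
  toGraph := G
  Dangling _ _ := False
  dangling_unique _ _ _ h := h.elim
  dangling_not_edge _ _ h := h.elim
  dangling_mem _ _ h := h.elim

/-- `G` has a proper edge-colouring with `k` colours. -/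
def EdgeColourable (G : Graph α β) (k : ℕ) : Prop := G.toDanglingGraph.EdgeColourable k

/-- `G - X`: the vertices in `X` are removed, and each edge between a removed and a remaining vertex
is retained as a dangling edge. -/
def removeVerts (G : Graph α β) (X : Set α) : DanglingGraph α β where
  toGraph := G.deleteVerts X
  Dangling e x := x ∉ X ∧ ∃ y ∈ X, G.IsLink e x y
  dangling_unique := by
    rintro e x y ⟨hx, x', hx', h⟩ ⟨hy, y', hy', h'⟩
    rcases h.left_eq_or_eq h' with rfl | rfl
    · rfl
    · exact absurd hy' hx
  dangling_not_edge := by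
    rintro e x ⟨hx, x', hx', h⟩ he
    rw [edgeSet_deleteVerts] at he
    obtain ⟨a, b, hab, ha, hb⟩ := he
    rcases h.right_eq_or_eq hab with rfl | rfl
    · exact ha hx'
    · exact hb hx'
  dangling_mem := by
    rintro e x ⟨hx, x', hx', h⟩
    rw [vertexSet_deleteVerts]
    exact ⟨h.left_mem, hx⟩

open Classical in
/-- `G/{u,v}`: the graph obtained by identifying `v` with `u`. All edges are kept; those between
`u` and `v` become loops. -/
noncomputable def identify (G : Graph α β) (u v : α) : Graph α β :=
  G.map (fun x => if x = v then u else x)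

/-- An orientation of a graph: every edge has one of its ends as tail and the other as head. -/
structure Orientation (G : Graph α β) where
  tail : G.edgeSet → α
  head : G.edgeSet → α
  isLink : ∀ e : G.edgeSet, G.IsLink e (tail e) (head e)

/-- A (finite) graph has a nowhere-zero `k`-flow: for some orientation there are nonzero integers
of absolute value less than `k` on the edges such that inflow equals outflow at every vertex. -/
def HasNowhereZeroFlow (G : Graph α β) (k : ℕ) : Prop :=
  ∃ (D : G.Orientation) (f : G.edgeSet → ℤ),
    (∀ e, f e ≠ 0 ∧ |f e| < (k : ℤ)) ∧
    ∀ x ∈ G.vertexSet,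
      ∑ᶠ (e : G.edgeSet) (_ : D.head e = x), f e = ∑ᶠ (e : G.edgeSet) (_ : D.tail e = x), f e

/-- A snark: a finite connected cubic graph with no proper 3-edge-colouring. -/
structure IsSnark (G : Graph α β) : Prop where
  finite_vertexSet : G.vertexSet.Finite
  finite_edgeSet : G.edgeSet.Finite
  connected : G.IsConnected
  cubic : G.IsCubic
  not_colourable : ¬ G.EdgeColourable 3

/-- `G - {u,v}` is 3-edge-colourable for any two distinct vertices `u` and `v`. -/
def IsBicritical (G : Graph α β) : Prop :=
  ∀ u ∈ G.vertexSet, ∀ v ∈ G.vertexSet, u ≠ v → (G.removeVerts {u, v}).EdgeColourable 3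

/-- `G/{u,v}` has a nowhere-zero 4-flow for any two distinct vertices `u` and `v`. -/
def IsFourVertexCritical (G : Graph α β) : Prop :=
  ∀ u ∈ G.vertexSet, ∀ v ∈ G.vertexSet, u ≠ v → (G.identify u v).HasNowhereZeroFlow 4

/-- `K` is isomorphic to a subgraph of `H`. -/
def EmbedsIn {α' β' : Type*} (K : Graph α β) (H : Graph α' β') : Prop :=
  ∃ (φ : α → α') (ψ : β → β'),
    InjOn φ K.vertexSet ∧ InjOn ψ K.edgeSet ∧ MapsTo φ K.vertexSet H.vertexSet ∧
      ∀ e x y, K.IsLink e x y → H.IsLink (ψ e) (φ x) (φ y)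

/-- `K` can be completed, by adding edges and vertices, to a (finite) cubic graph with fewer than
`n` vertices. Every finite graph is isomorphic to one with vertices and edges in `ℕ`. -/
def HasCubicCompletionBelow (K : Graph α β) (n : ℕ∞) : Prop :=
  ∃ H : Graph ℕ ℕ, H.IsCubic ∧ H.vertexSet.encard < n ∧ K.EmbedsIn H

/-- Removing fewer than `k` edges from `G` never leaves a component that is not 3-edge-colourable
and can be completed to a cubic graph of order smaller than that of `G`. -/
def IsKIrreducible (G : Graph α β) (k : ℕ) : Prop :=
  ∀ S : Set β, S ⊆ G.edgeSet → S.encard < (k : ℕ∞) →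
    ∀ K : Graph α β, K.IsComponentOf (G.deleteEdges S) → ¬ K.EdgeColourable 3 →
      ¬ K.HasCubicCompletionBelow G.vertexSet.encard

/-- `G` is `k`-irreducible for every `k ≥ 1`. -/
def IsIrreducible (G : Graph α β) : Prop := ∀ k : ℕ, 1 ≤ k → G.IsKIrreducible k

end Graph

/-! Three nonzero elements of the Klein four-group sum to zero exactly when they are distinct. At a
vertex of degree 3, proper colouring is therefore conservation of a nowhere-zero Klein flow. Such
flows exist exactly when integer 4-flows do (`exists_four_flow_iff`), and conservation at all
vertices but one implies it at the last (`isBinaryFlow_of_forall_ne`). So colourings of G - {u,v}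
correspond to flows of G/{u,v}: the merged vertex imposes no condition of its own.

If G is bicritical, an uncolourable component K left by an edge removal misses at most one vertex of
G, since a subgraph avoiding two vertices inherits a colouring. Cubic graphs have even order, so a
smaller cubic graph has at least two vertices fewer than G and is too small to contain K.

Conversely, delete the at most six edges at u and v. Every component apart from u and v themselves
has maximum degree at most 3 and at most |G| - 2 vertices, and one extra vertex suffices to complete
it to a cubic graph (`exists_cubic_completion`). Hence 7-irreducibility makes it colourable. The
colourings of the components combine, and then extend to the dangling edges independently at each
remaining vertex. -/

namespace Graph

open Set

/-! ### Integer 4-flows and Klein four-group flows -/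

section Signing

variable {V E : Type*}

open Classical in
/-- A graph in which all degrees are even has an Eulerian orientation: the edges with sign `-1` are
the ones to be reversed. -/
theorem exists_eulerian_signs (A : Finset E) (t h : E → V)
    (hA : ∀ v, ∑ e ∈ A, ((if h e = v then 1 else 0) + (if t e = v then 1 else 0) : ZMod 2) = 0) :
    ∃ s : E → ℤ, (∀ e, s e = 1 ∨ s e = -1) ∧
      ∀ v, ∑ e ∈ A, s e * ((if h e = v then 1 else 0) - (if t e = v then 1 else 0)) = 0 := by
  induction hn : A.card generalizing A t h with
  | zero =>
    rw [Finset.card_eq_zero] at hn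
    exact ⟨fun _ => 1, by simp, by simp [hn]⟩
  | succ n ih =>
    obtain ⟨e, he⟩ : A.Nonempty := Finset.card_pos.1 (by omega)
    have hcard : (A.erase e).card = n := by rw [Finset.card_erase_of_mem he, hn]; rfl
    by_cases hloop : h e = t e
    · obtain ⟨s, hs, hs'⟩ := ih (A.erase e) t h (fun v => by
        have h1 := hA v
        rwa [← Finset.add_sum_erase A _ he, hloop, CharTwo.add_self_eq_zero, zero_add] at h1) hcard
      exact ⟨s, hs, fun v => by rw [← Finset.add_sum_erase A _ he, hs' v, hloop]; simp⟩
    -- Even degree at `h e` supplies a second edge `f` there. The induction splices `e` and `f` into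
    -- one edge, by moving an end of `f` from `h e` to `t e`.
    · obtain ⟨f, hf, hfe⟩ : ∃ f ∈ A.erase e, h f = h e ∨ t f = h e := by
        by_contra! hcon
        have := hA (h e)
        rw [← Finset.add_sum_erase A _ he, Finset.sum_eq_zero] at this
        · simp [Ne.symm hloop] at this
        · intro f hf
          simp [hcon f hf]
      have hne : f ≠ e := Finset.ne_of_mem_erase hf
      have split {M : Type _} [AddCommMonoid M] (g : E → M) :
          ∑ x ∈ A, g x = g e + (g f + ∑ x ∈ (A.erase e).erase f, g x) := by
        rw [← Finset.add_sum_erase A _ he, ← Finset.add_sum_erase _ _ hf]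
      have split' {M : Type _} [AddCommMonoid M] (g : E → M) :
          ∑ x ∈ A.erase e, g x = g f + ∑ x ∈ (A.erase e).erase f, g x := by
        rw [← Finset.add_sum_erase _ _ hf]
      have hB : ∀ x ∈ (A.erase e).erase f, x ≠ f ∧ x ≠ e := fun x hx =>
        ⟨Finset.ne_of_mem_erase hx, Finset.ne_of_mem_erase (Finset.mem_of_mem_erase hx)⟩
      rcases hfe with hfe | hfe
      · obtain ⟨s, hs, hs'⟩ := ih (A.erase e) t (Function.update h f (t e)) (fun v => by
          have h1 := hA v
          rw [split] at h1
          have h2 : ∑ x ∈ (A.erase e).erase f, ((if Function.update h f (t e) x = v then 1 else 0)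
              + (if t x = v then 1 else 0) : ZMod 2) = ∑ x ∈ (A.erase e).erase f,
              ((if h x = v then 1 else 0) + (if t x = v then 1 else 0)) :=
            Finset.sum_congr rfl fun x hx => by rw [Function.update_of_ne (hB x hx).1]
          rw [split', h2, Function.update_self]
          rw [hfe] at h1
          linear_combination h1 - CharTwo.add_self_eq_zero (if h e = v then (1 : ZMod 2) else 0))
          hcard
        -- The walk along `f` and then `e` runs against `e`, hence the opposite sign.
        refine ⟨Function.update s e (-s f), fun x => ?_, fun v => ?_⟩
        · by_cases hx : x = e
          · subst hx; rcases hs f with h | h <;> simp [h]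
          · rw [Function.update_of_ne hx]; exact hs x
        · have h1 := hs' v
          have h2 : ∑ x ∈ (A.erase e).erase f, s x * ((if Function.update h f (t e) x = v then 1 else 0)
              - (if t x = v then 1 else 0)) = ∑ x ∈ (A.erase e).erase f,
              s x * ((if h x = v then 1 else 0) - (if t x = v then 1 else 0)) :=
            Finset.sum_congr rfl fun x hx => by rw [Function.update_of_ne (hB x hx).1]
          have h3 : ∑ x ∈ (A.erase e).erase f, Function.update s e (-s f) x *
              ((if h x = v then 1 else 0) - (if t x = v then 1 else 0)) =
              ∑ x ∈ (A.erase e).erase f,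
                s x * ((if h x = v then 1 else 0) - (if t x = v then 1 else 0)) :=
            Finset.sum_congr rfl fun x hx => by rw [Function.update_of_ne (hB x hx).2]
          rw [split', h2, Function.update_self] at h1
          rw [split, h3, Function.update_self, Function.update_of_ne hne, hfe]
          linear_combination h1
      · obtain ⟨s, hs, hs'⟩ := ih (A.erase e) (Function.update t f (t e)) h (fun v => by
          have h1 := hA v
          rw [split] at h1
          have h2 : ∑ x ∈ (A.erase e).erase f, ((if h x = v then 1 else 0)
              + (if Function.update t f (t e) x = v then 1 else 0) : ZMod 2) = ∑ x ∈ (A.erase e).erase f,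
              ((if h x = v then 1 else 0) + (if t x = v then 1 else 0)) :=
            Finset.sum_congr rfl fun x hx => by rw [Function.update_of_ne (hB x hx).1]
          rw [split', h2, Function.update_self]
          rw [hfe] at h1
          linear_combination h1 - CharTwo.add_self_eq_zero (if h e = v then (1 : ZMod 2) else 0))
          hcard
        -- Here `e` followed by `f` is a directed walk, so the signs agree.
        refine ⟨Function.update s e (s f), fun x => ?_, fun v => ?_⟩
        · by_cases hx : x = e
          · subst hx; simpa using hs f
          · rw [Function.update_of_ne hx]; exact hs x
        · have h1 := hs' v
          have h2 : ∑ x ∈ (A.erase e).erase f, s x * ((if h x = v then 1 else 0)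
              - (if Function.update t f (t e) x = v then 1 else 0)) = ∑ x ∈ (A.erase e).erase f,
              s x * ((if h x = v then 1 else 0) - (if t x = v then 1 else 0)) :=
            Finset.sum_congr rfl fun x hx => by rw [Function.update_of_ne (hB x hx).1]
          have h3 : ∑ x ∈ (A.erase e).erase f, Function.update s e (s f) x *
              ((if h x = v then 1 else 0) - (if t x = v then 1 else 0)) =
              ∑ x ∈ (A.erase e).erase f,
                s x * ((if h x = v then 1 else 0) - (if t x = v then 1 else 0)) :=
            Finset.sum_congr rfl fun x hx => by rw [Function.update_of_ne (hB x hx).2]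
          rw [split', h2, Function.update_self] at h1
          rw [split, h3, Function.update_self, Function.update_of_ne hne, hfe]
          linear_combination h1

variable [Fintype E]

open Classical in
/-- A flow modulo 2 lifts to an integer 2-flow. -/
theorem exists_two_flow (t h : E → V) (a : E → ZMod 2)
    (ha : ∀ v, ∑ e, a e * ((if h e = v then 1 else 0) + (if t e = v then 1 else 0)) = 0) :
    ∃ g : E → ℤ, (∀ e, a e = 0 → g e = 0) ∧ (∀ e, a e ≠ 0 → g e = 1 ∨ g e = -1) ∧
      ∀ v, ∑ e, g e * ((if h e = v then 1 else 0) - (if t e = v then 1 else 0)) = 0 := by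
  obtain ⟨s, hs, hs'⟩ := exists_eulerian_signs (Finset.univ.filter (a · ≠ 0)) t h (fun v => by
    refine Eq.trans ?_ (ha v)
    rw [Finset.sum_filter]
    refine Finset.sum_congr rfl fun e _ => ?_
    have key : ∀ x : ZMod 2, x = 0 ∨ x = 1 := by decide
    rcases key (a e) with h | h <;> simp [h])
  refine ⟨fun e => if a e ≠ 0 then s e else 0, fun e he => by simp [he],
    fun e he => by simpa [he] using hs e, fun v => ?_⟩
  refine Eq.trans ?_ (hs' v)
  rw [Finset.sum_filter]
  exact Finset.sum_congr rfl fun e _ => by simp only [ite_mul, zero_mul]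

open Classical in
/-- Integer nowhere-zero 4-flows and nowhere-zero flows in the Klein four-group coexist. -/
theorem exists_four_flow_iff (t h : E → V) :
    (∃ f : E → ℤ, (∀ e, f e ≠ 0 ∧ |f e| < 4) ∧
      ∀ v, ∑ e, f e * ((if h e = v then 1 else 0) - (if t e = v then 1 else 0)) = 0) ↔
    ∃ a b : E → ZMod 2, (∀ e, a e ≠ 0 ∨ b e ≠ 0) ∧
      (∀ v, ∑ e, a e * ((if h e = v then 1 else 0) + (if t e = v then 1 else 0)) = 0) ∧
      ∀ v, ∑ e, b e * ((if h e = v then 1 else 0) + (if t e = v then 1 else 0)) = 0 := by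
  have cast (f : E → ℤ)
      (hf : ∀ v, ∑ e, f e * ((if h e = v then 1 else 0) - (if t e = v then 1 else 0)) = 0) (v : V) :
      ∑ e, (f e : ZMod 2) * ((if h e = v then 1 else 0) + (if t e = v then 1 else 0)) = 0 := by
    have := congrArg (Int.cast : ℤ → ZMod 2) (hf v)
    push_cast at this
    simpa only [CharTwo.sub_eq_add] using this
  constructor
  · rintro ⟨f, hf, hflow⟩
    obtain ⟨g, hg0, hg1, hg⟩ := exists_two_flow t h (fun e => (f e : ZMod 2)) (cast f hflow)
    -- `g` lifts `f` modulo 2, so `f + g` is even and half of it is again an integer flow.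
    have hdiv : ∀ e, f e + g e = 2 * ((f e + g e) / 2) := by
      intro e
      by_cases he : (f e : ZMod 2) = 0
      · have h2 := (ZMod.intCast_zmod_eq_zero_iff_dvd _ 2).1 he
        have := hg0 e he
        push_cast at h2
        omega
      · have h2 : ¬ (2 : ℤ) ∣ f e := fun hd => he ((ZMod.intCast_zmod_eq_zero_iff_dvd _ 2).2 hd)
        have := hg1 e he
        omega
    refine ⟨fun e => (f e : ZMod 2), fun e => (((f e + g e) / 2 : ℤ) : ZMod 2), fun e => ?_,
      cast f hflow, cast (fun e => (f e + g e) / 2) fun v => ?_⟩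
    -- If both coordinates vanish, then `g e = 0` and 4 divides `f e`, contrary to 0 < |f e| < 4.
    · by_contra! hcon
      have h2 := (ZMod.intCast_zmod_eq_zero_iff_dvd _ 2).1 hcon.1
      have h3 := (ZMod.intCast_zmod_eq_zero_iff_dvd _ 2).1 hcon.2
      push_cast at h2 h3
      have := hg0 e hcon.1
      obtain ⟨h4, h5⟩ := hf e
      rw [abs_lt] at h5
      omega
    · have h1 := congrArg₂ (· + ·) (hflow v) (hg v)
      simp only [← Finset.sum_add_distrib, ← add_mul, add_zero] at h1
      rw [Finset.sum_congr rfl fun e _ => by rw [hdiv e, mul_assoc], ← Finset.mul_sum] at h1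
      simpa using h1
  · rintro ⟨a, b, hab, ha, hb⟩
    obtain ⟨g, hg0, hg1, hg⟩ := exists_two_flow t h a ha
    obtain ⟨k, hk0, hk1, hk⟩ := exists_two_flow t h b hb
    -- With `g` and `k` valued in {-1, 0, 1} and not both zero, `2g + k` is nonzero and at most 3 in
    -- absolute value.
    refine ⟨fun e => 2 * g e + k e, fun e => ?_, fun v => ?_⟩
    · have h1 := hg0 e
      have h2 := hg1 e
      have h3 := hk0 e
      have h4 := hk1 e
      have h5 := hab e
      change 2 * g e + k e ≠ 0 ∧ |2 * g e + k e| < 4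
      rw [abs_lt]
      by_cases h6 : a e = 0 <;> by_cases h7 : b e = 0 <;> simp [h6, h7] at h1 h2 h3 h4 h5 <;> omega
    · simp only [add_mul, Finset.sum_add_distrib, mul_assoc, ← Finset.mul_sum, hg v, hk v]
      rfl

end Signing

/-! ### Flows on graphs -/

variable {α β : Type*} {G : Graph α β}

theorem nonempty_orientation (G : Graph α β) : Nonempty G.Orientation := by
  choose t h hth using fun e : G.edgeSet => exists_isLink_of_mem_edgeSet e.2
  exact ⟨⟨t, h, hth⟩⟩

-- Modulo 2 the two ends of a loop cancel and orientation is irrelevant.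
open Classical in
theorem Orientation.isNonloopAt_iff (D : G.Orientation) (e : G.edgeSet) (x : α) :
    ((if D.head e = x then 1 else 0) + (if D.tail e = x then 1 else 0) : ZMod 2) =
      if G.IsNonloopAt e x then 1 else 0 := by
  have hl := D.isLink e
  have hiff : G.IsNonloopAt e x ↔
      (D.head e = x ∧ D.tail e ≠ x) ∨ (D.head e ≠ x ∧ D.tail e = x) := by
    constructor
    · rintro ⟨y, hy, hxy⟩
      rcases hl.eq_and_eq_or_eq_and_eq hxy with ⟨h1, h2⟩ | ⟨h1, h2⟩ <;> grind
    · rintro (⟨rfl, h2⟩ | ⟨h1, rfl⟩)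
      · exact ⟨_, h2, hl.symm⟩
      · exact ⟨_, h1, hl⟩
  rw [if_congr hiff rfl rfl]
  by_cases h1 : D.head e = x <;> by_cases h2 : D.tail e = x <;> simp [h1, h2]; decide

/-- A flow in an abelian group of exponent 2, where orientations do not matter. -/
def IsBinaryFlow {A : Type*} [AddCommMonoid A] (G : Graph α β) (a : β → A) : Prop :=
  ∀ x, ∑ᶠ e ∈ {e | G.IsNonloopAt e x}, a e = 0

open Classical in
theorem finsum_isNonloopAt {A : Type*} [AddCommMonoid A] [Fintype G.edgeSet] (a : β → A) (x : α) :
    ∑ᶠ e ∈ {e | G.IsNonloopAt e x}, a e =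
      ∑ e : G.edgeSet, if G.IsNonloopAt e x then a e else 0 := by
  have : ∑ᶠ e ∈ {e | G.IsNonloopAt e x}, a e =
      ∑ᶠ e ∈ G.edgeSet, if G.IsNonloopAt e x then a e else 0 := by
    refine finsum_congr fun e => ?_
    by_cases h : G.IsNonloopAt e x
    · simp [h, h.edge_mem]
    · simp [h]
  rw [this, ← finsum_set_coe_eq_finsum_mem, finsum_eq_sum_of_fintype]

open Classical in
theorem Orientation.conservation_iff (D : G.Orientation) [Fintype G.edgeSet] (f : G.edgeSet → ℤ) :
    (∀ x ∈ G.vertexSet,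
      ∑ᶠ (e : G.edgeSet) (_ : D.head e = x), f e = ∑ᶠ (e : G.edgeSet) (_ : D.tail e = x), f e) ↔
    ∀ x, ∑ e, f e * ((if D.head e = x then 1 else 0) - (if D.tail e = x then 1 else 0)) = 0 := by
  have key (x : α) :
      ∑ e, f e * ((if D.head e = x then 1 else 0) - (if D.tail e = x then 1 else 0)) =
      ∑ᶠ (e : G.edgeSet) (_ : D.head e = x), f e - ∑ᶠ (e : G.edgeSet) (_ : D.tail e = x), f e := by
    simp only [mul_sub, Finset.sum_sub_distrib, mul_ite, mul_one, mul_zero, finsum_eq_if,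
      finsum_eq_sum_of_fintype]
  simp only [key, sub_eq_zero]
  refine ⟨fun h x => ?_, fun h x _ => h x⟩
  by_cases hx : x ∈ G.vertexSet
  · exact h x hx
  · have h1 (e : G.edgeSet) : D.head e ≠ x := fun he => hx (he ▸ (D.isLink e).right_mem)
    have h2 (e : G.edgeSet) : D.tail e ≠ x := fun he => hx (he ▸ (D.isLink e).left_mem)
    simp [h1, h2]

theorem hasNowhereZeroFlow_four_iff (hfin : G.edgeSet.Finite) :
    G.HasNowhereZeroFlow 4 ↔
      ∃ a : β → ZMod 2 × ZMod 2, (∀ e ∈ G.edgeSet, a e ≠ 0) ∧ G.IsBinaryFlow a := by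
  classical
  have := hfin.fintype
  have key (D : G.Orientation) (a : β → ZMod 2) (x : α) :
      ∑ e : G.edgeSet, a e * ((if D.head e = x then 1 else 0) + (if D.tail e = x then 1 else 0)) =
      ∑ e : G.edgeSet, if G.IsNonloopAt e x then a e else 0 :=
    Finset.sum_congr rfl fun e _ => by rw [D.isNonloopAt_iff]; simp
  constructor
  · rintro ⟨D, f, hf, hflow⟩
    obtain ⟨a, b, hab, ha, hb⟩ := (exists_four_flow_iff D.tail D.head).1
      ⟨f, hf, (D.conservation_iff f).1 hflow⟩
    let a' : β → ZMod 2 := Function.extend Subtype.val a 0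
    let b' : β → ZMod 2 := Function.extend Subtype.val b 0
    have ha' (e : G.edgeSet) : a' e = a e := Subtype.val_injective.extend_apply a 0 e
    have hb' (e : G.edgeSet) : b' e = b e := Subtype.val_injective.extend_apply b 0 e
    refine ⟨fun e => (a' e, b' e), fun e he h0 => ?_, fun x => ?_⟩
    · have h1 := hab ⟨e, he⟩
      rw [← ha', ← hb'] at h1
      rw [Prod.mk_eq_zero] at h0
      simp_all
    · rw [finsum_isNonloopAt]
      have h1 := ha x
      have h2 := hb x
      simp only [← ha', ← hb', key] at h1 h2
      ext
      · simpa [Prod.fst_sum, apply_ite Prod.fst] using h1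
      · simpa [Prod.snd_sum, apply_ite Prod.snd] using h2
  · rintro ⟨a, ha, hflow⟩
    obtain ⟨D⟩ := nonempty_orientation G
    have h (x : α) := (finsum_isNonloopAt a x).symm.trans (hflow x)
    obtain ⟨f, hf, hf'⟩ := (exists_four_flow_iff D.tail D.head).2
      ⟨fun e => (a e).1, fun e => (a e).2, fun e => by
        by_contra! hcon
        exact ha e e.2 (Prod.ext hcon.1 hcon.2),
        fun x => by
          have h1 := congrArg Prod.fst (h x)
          simp only [Prod.fst_sum, apply_ite Prod.fst, Prod.fst_zero] at h1
          exact (key D (fun e => (a e).1) x).trans h1,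
        fun x => by
          have h1 := congrArg Prod.snd (h x)
          simp only [Prod.snd_sum, apply_ite Prod.snd, Prod.snd_zero] at h1
          exact (key D (fun e => (a e).2) x).trans h1⟩
    exact ⟨D, f, hf, (D.conservation_iff f).2 hf'⟩

/-- In a group of exponent 2 it is enough to check conservation at all vertices but one. -/
theorem isBinaryFlow_of_forall_ne {A : Type*} [AddCommMonoid A] (hA : ∀ a : A, a + a = 0)
    (hV : G.vertexSet.Finite) (hE : G.edgeSet.Finite) (a : β → A) (u : α)
    (h : ∀ x ∈ G.vertexSet, x ≠ u → ∑ᶠ e ∈ {e | G.IsNonloopAt e x}, a e = 0) :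
    G.IsBinaryFlow a := by
  classical
  have := hE.fintype
  have hout (x : α) (hx : x ∉ G.vertexSet) : ∑ᶠ e ∈ {e | G.IsNonloopAt e x}, a e = 0 := by
    have : {e | G.IsNonloopAt e x} = ∅ :=
      Set.eq_empty_of_forall_notMem fun e (he : G.IsNonloopAt e x) => hx he.vertex_mem
    simp [this]
  -- Summed over all vertices, each non-loop edge is counted twice and each loop not at all.
  have htotal : ∑ x ∈ hV.toFinset, ∑ᶠ e ∈ {e | G.IsNonloopAt e x}, a e = 0 := by
    simp only [finsum_isNonloopAt]
    rw [Finset.sum_comm]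
    refine Finset.sum_eq_zero fun e _ => ?_
    obtain ⟨y, z, hyz⟩ := exists_isLink_of_mem_edgeSet e.2
    by_cases hne : y = z
    · subst hne
      exact Finset.sum_eq_zero fun x _ => if_neg (IsLoopAt.not_isNonloopAt hyz x)
    · have hiff (x : α) : G.IsNonloopAt e x ↔ x ∈ ({y, z} : Finset α) := by
        simp only [Finset.mem_insert, Finset.mem_singleton]
        constructor
        · exact fun h => h.inc.eq_or_eq_of_isLink hyz
        · rintro (rfl | rfl)
          · exact ⟨z, Ne.symm hne, hyz⟩
          · exact ⟨y, hne, hyz.symm⟩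
      have hsub : ({y, z} : Finset α) ⊆ hV.toFinset := by
        intro x hx
        simpa using ((hiff x).2 hx).vertex_mem
      simp only [hiff]
      rw [Finset.sum_ite_mem, Finset.inter_eq_right.2 hsub, Finset.sum_pair hne, hA]
  intro x
  by_cases hx : x ∈ G.vertexSet
  · by_cases hxu : x = u
    · subst hxu
      rwa [Finset.sum_eq_single_of_mem x (by simpa using hx) fun y hy hyx =>
        h y (by simpa using hy) hyx] at htotal
    · exact h x hx hxu
  · exact hout x hx

/-! ### Flows and colourings at a vertex of degree 3 -/

theorem isNonloopAt_eq_sdiff (G : Graph α β) (x : α) :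
    {e | G.IsNonloopAt e x} = G.incidenceSet x \ G.loopSet x := by
  ext e
  exact isNonloopAt_iff_inc_not_isLoopAt

theorem encard_incidenceSet_of_loopless {x : α} (h3 : G.vertexDegree x = 3)
    (hl : ∀ e, ¬ G.IsLoopAt e x) : (G.incidenceSet x).encard = 3 := by
  have : G.loopSet x = ∅ := Set.eq_empty_of_forall_notMem hl
  simpa [vertexDegree, this] using h3

/-- The nonzero elements of the Klein four-group, as colours. -/
def kleinColour : Fin 3 → ZMod 2 × ZMod 2 := ![(1, 0), (0, 1), (1, 1)]

theorem kleinColour_ne_zero : ∀ i, kleinColour i ≠ 0 := by decide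

theorem exists_kleinColour_eq : ∀ p, p ≠ 0 → ∃ i, kleinColour i = p := by decide

theorem kleinColour_add_eq_zero :
    ∀ i j k, i ≠ j → i ≠ k → j ≠ k → kleinColour i + (kleinColour j + kleinColour k) = 0 := by
  decide

/-- Two equal summands would cancel and force the third to be zero. -/
theorem klein_ne_of_add_eq_zero : ∀ p q r : ZMod 2 × ZMod 2, p ≠ 0 → q ≠ 0 → r ≠ 0 →
    p + (q + r) = 0 → p ≠ q ∧ p ≠ r ∧ q ≠ r := by
  decide

theorem finsum_mem_triple {M : Type*} [AddCommMonoid M] (a : β → M) {x y z : β} (hxy : x ≠ y)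
    (hxz : x ≠ z) (hyz : y ≠ z) : ∑ᶠ e ∈ ({x, y, z} : Set β), a e = a x + (a y + a z) := by
  rw [finsum_mem_insert _ (by simp [hxy, hxz]) (by simp), finsum_mem_pair hyz]

/-- A proper colouring at a vertex of degree 3 satisfies conservation there. -/
theorem finsum_kleinColour_eq_zero {x : α} (h3 : G.vertexDegree x = 3)
    (hl : ∀ e, ¬ G.IsLoopAt e x) {c : β → Fin 3} (hc : InjOn c (G.incidenceSet x)) :
    ∑ᶠ e ∈ {e | G.IsNonloopAt e x}, kleinColour (c e) = 0 := by
  obtain ⟨e, f, g, hef, heg, hfg, hs⟩ :=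
    Set.encard_eq_three.1 (encard_incidenceSet_of_loopless h3 hl)
  have hl' : G.loopSet x = ∅ := Set.eq_empty_of_forall_notMem hl
  rw [isNonloopAt_eq_sdiff, hl', sdiff_empty, hs, finsum_mem_triple _ hef heg hfg]
  rw [hs] at hc
  exact kleinColour_add_eq_zero _ _ _ (hc.ne (by simp) (by simp) hef)
    (hc.ne (by simp) (by simp) heg) (hc.ne (by simp) (by simp) hfg)

/-- Conservation of a nowhere-zero flow in the Klein four-group at a vertex of degree 3. -/
theorem injOn_of_finsum_eq_zero {x : α} (h3 : G.vertexDegree x = 3)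
    {a : β → ZMod 2 × ZMod 2} (ha : ∀ e ∈ G.edgeSet, a e ≠ 0)
    (hsum : ∑ᶠ e ∈ {e | G.IsNonloopAt e x}, a e = 0) :
    (∀ e, ¬ G.IsLoopAt e x) ∧ InjOn a (G.incidenceSet x) := by
  -- A loop uses two of the three ends, so conservation would make the single other edge carry zero.
  have hl : ∀ e, ¬ G.IsLoopAt e x := by
    intro l hl
    have h1 : (G.loopSet x).encard ≥ 1 := Set.one_le_encard_iff_nonempty.2 ⟨l, hl⟩
    have h2 := Set.encard_sdiff_add_encard_of_subset (G.loopSet_subset_incidenceSet x)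
    rw [← isNonloopAt_eq_sdiff] at h2
    have h4 : {e | G.IsNonloopAt e x}.encard = 1 := by
      rw [vertexDegree, ← h2] at h3
      generalize {e | G.IsNonloopAt e x}.encard = n at *
      generalize (G.loopSet x).encard = m at *
      cases n with
      | top => simp at h3
      | coe n => cases m with
        | top => simp at h3
        | coe m => norm_cast at *; omega
    obtain ⟨g, hg⟩ := Set.encard_eq_one.1 h4
    rw [hg, finsum_mem_singleton] at hsum
    have hg' : G.IsNonloopAt g x := (Set.ext_iff.1 hg g).2 rfl
    exact ha g hg'.edge_mem hsum
  refine ⟨hl, ?_⟩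
  obtain ⟨e, f, g, hef, heg, hfg, hs⟩ :=
    Set.encard_eq_three.1 (encard_incidenceSet_of_loopless h3 hl)
  have hl' : G.loopSet x = ∅ := Set.eq_empty_of_forall_notMem hl
  rw [isNonloopAt_eq_sdiff, hl', sdiff_empty, hs, finsum_mem_triple _ hef heg hfg] at hsum
  have hmem : ∀ y ∈ ({e, f, g} : Set β), a y ≠ 0 := fun y hy =>
    ha y (G.incidenceSet_subset_edgeSet x (hs ▸ hy))
  obtain ⟨h1, h2, h4⟩ := klein_ne_of_add_eq_zero _ _ _ (hmem e (by simp)) (hmem f (by simp))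
    (hmem g (by simp)) hsum
  rw [hs]
  rintro y (rfl | rfl | rfl) z (rfl | rfl | rfl) hyz <;> grind

/-! ### Colourings of G - {u,v} and flows of G/{u,v} -/

theorem removeVerts_incident_iff {X : Set α} {e : β} {x : α} :
    (G.removeVerts X).Incident e x ↔ x ∉ X ∧ G.Inc e x := by
  constructor
  · rintro (⟨y, hy⟩ | ⟨hx, y, -, hy⟩)
    · obtain ⟨h, hx, -⟩ := (deleteVerts_isLink G X).1 hy
      exact ⟨hx, y, h⟩
    · exact ⟨hx, y, hy⟩
  · rintro ⟨hx, y, hy⟩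
    by_cases hyX : y ∈ X
    · exact .inr ⟨hx, y, hyX, hy⟩
    · exact .inl ⟨y, (deleteVerts_isLink G X).2 ⟨hy, hx, hyX⟩⟩

/-- Because dangling edges are kept, a vertex outside `X` sees the same edges as in `G`, and only
the conditions at `X` are dropped. -/
theorem removeVerts_edgeColourable_iff {X : Set α} {k : ℕ} :
    (G.removeVerts X).EdgeColourable k ↔
      ∃ c : β → Fin k, ∀ x ∉ X, (∀ e, ¬ G.IsLoopAt e x) ∧ InjOn c (G.incidenceSet x) := by
  refine exists_congr fun c => ⟨fun ⟨h1, h2⟩ x hx => ⟨fun e he => h1 e x ?_, ?_⟩,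
    fun h => ⟨fun e x he => ?_, fun e f x hef he hf hc => ?_⟩⟩
  · exact (deleteVerts_isLink G X).2 ⟨he, hx, hx⟩
  · intro e he f hf hc
    by_contra hef
    exact h2 e f x hef (removeVerts_incident_iff.2 ⟨hx, he⟩)
      (removeVerts_incident_iff.2 ⟨hx, hf⟩) hc
  · obtain ⟨h1, hx, -⟩ := (deleteVerts_isLink G X).1 he
    exact (h x hx).1 e h1
  · obtain ⟨hx, he⟩ := removeVerts_incident_iff.1 he
    exact hef ((h x hx).2 he (removeVerts_incident_iff.1 hf).2 hc)

theorem identify_isNonloopAt_iff {u v x : α} {e : β} (hu : x ≠ u) (hv : x ≠ v) :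
    (G.identify u v).IsNonloopAt e x ↔ G.IsNonloopAt e x := by
  constructor
  · rintro ⟨y, hy, x', y', h, hx', rfl⟩
    have : x' = x := by grind
    subst this
    exact ⟨y', by grind, h⟩
  · rintro ⟨y, hy, h⟩
    refine ⟨_, ?_, x, y, h, if_neg hv, rfl⟩
    grind

/-- For a cubic graph, colourings of `G - {u,v}` correspond to nowhere-zero 4-flows
of `G/{u,v}`. -/
theorem removeVerts_edgeColourable_iff_identify (hV : G.vertexSet.Finite) (hE : G.edgeSet.Finite)
    (hG : G.IsCubic) {u v : α} :
    (G.removeVerts {u, v}).EdgeColourable 3 ↔ (G.identify u v).HasNowhereZeroFlow 4 := by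
  have hset {x : α} (hu : x ≠ u) (hv : x ≠ v) :
      {e | (G.identify u v).IsNonloopAt e x} = {e | G.IsNonloopAt e x} :=
    Set.ext fun e => identify_isNonloopAt_iff hu hv
  rw [removeVerts_edgeColourable_iff,
    hasNowhereZeroFlow_four_iff (show (G.identify u v).edgeSet.Finite from hE)]
  constructor
  · rintro ⟨c, hc⟩
    refine ⟨fun e => kleinColour (c e), fun e _ => kleinColour_ne_zero _,
      isBinaryFlow_of_forall_ne (G := G.identify u v) CharTwo.add_self_eq_zero (hV.image _) hE _ u ?_⟩
    rintro _ ⟨x, hx, rfl⟩ hxu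
    have hxv : x ≠ v := by grind
    beta_reduce at hxu ⊢
    rw [if_neg hxv] at hxu ⊢
    rw [hset hxu hxv]
    obtain ⟨h1, h2⟩ := hc x (by simp [hxu, hxv])
    exact finsum_kleinColour_eq_zero (hG x hx) h1 h2
  · rintro ⟨a, ha, hflow⟩
    choose! c hc using exists_kleinColour_eq
    refine ⟨fun e => c (a e), fun x hx => ?_⟩
    have hxu : x ≠ u := by grind
    have hxv : x ≠ v := by grind
    by_cases hxG : x ∈ G.vertexSet
    · have h := hflow x
      rw [hset hxu hxv] at h
      obtain ⟨h1, h2⟩ := injOn_of_finsum_eq_zero (hG x hxG) ha h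
      refine ⟨h1, fun e he f hf hef => h2 he hf ?_⟩
      rw [← hc (a e) (ha e (Inc.edge_mem (G := G) he)), ← hc (a f) (ha f (Inc.edge_mem (G := G) hf))]
      exact congrArg kleinColour hef
    · exact ⟨fun e he => hxG he.vertex_mem, fun e he => absurd (Inc.vertex_mem he) hxG⟩

/-! ### Degree counting and parity -/

/-- The degree of a vertex counts the indices of the edges with tail and with head there. -/
theorem vertexDegree_eq {ι : Type*} {t h : ι → α} {k : ι → β} (hk : Function.Injective k)
    (hG : ∀ e x y, G.IsLink e x y ↔
      ∃ i, k i = e ∧ (t i = x ∧ h i = y ∨ t i = y ∧ h i = x)) (x : α) :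
    G.vertexDegree x = {i | t i = x}.encard + {i | h i = x}.encard := by
  -- Incident edges form the union of the two index sets and loops the intersection, so
  -- inclusion-exclusion gives the degree.
  have h1 : G.incidenceSet x = k '' ({i | t i = x} ∪ {i | h i = x}) := by
    ext e
    simp only [mem_incidenceSet, Inc, hG, mem_image, mem_union, mem_ofPred_eq]
    grind
  have h2 : G.loopSet x = k '' ({i | t i = x} ∩ {i | h i = x}) := by
    ext e
    simp only [mem_loopSet, IsLoopAt, hG, mem_image, mem_inter_iff, mem_ofPred_eq]
    grind
  rw [vertexDegree, h1, h2, hk.encard_image, hk.encard_image, encard_union_add_encard_inter]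

theorem Orientation.isLink_iff (D : G.Orientation) (e : β) (x y : α) :
    G.IsLink e x y ↔ ∃ i : G.edgeSet, (i : β) = e ∧
      (D.tail i = x ∧ D.head i = y ∨ D.tail i = y ∧ D.head i = x) := by
  constructor
  · intro h
    exact ⟨⟨e, h.edge_mem⟩, rfl, (D.isLink ⟨e, h.edge_mem⟩).eq_and_eq_or_eq_and_eq h⟩
  · rintro ⟨i, rfl, ⟨rfl, rfl⟩ | ⟨rfl, rfl⟩⟩
    · exact D.isLink i
    · exact (D.isLink i).symm

theorem Orientation.vertexDegree_eq (D : G.Orientation) (x : α) :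
    G.vertexDegree x = {e | D.tail e = x}.encard + {e | D.head e = x}.encard :=
  Graph.vertexDegree_eq Subtype.val_injective D.isLink_iff x

theorem IsCubic.finite_edgeSet (hG : G.IsCubic) (hV : G.vertexSet.Finite) : G.edgeSet.Finite := by
  refine (hV.biUnion (t := G.incidenceSet) fun x hx => ?_).subset fun e he => ?_
  · have h3 := hG x hx
    rw [← Set.encard_ne_top_iff]
    intro htop
    simp [vertexDegree, htop] at h3
  · obtain ⟨x, y, h⟩ := exists_isLink_of_mem_edgeSet he
    exact mem_biUnion h.left_mem h.inc_left

/-- A finite cubic graph has an even number of vertices. -/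
theorem IsCubic.even_ncard (hG : G.IsCubic) (hV : G.vertexSet.Finite) :
    Even G.vertexSet.ncard := by
  classical
  have := (hG.finite_edgeSet hV).fintype
  obtain ⟨D⟩ := nonempty_orientation G
  have hdeg : ∀ x ∈ hV.toFinset, (Finset.univ.filter (D.tail · = x)).card +
      (Finset.univ.filter (D.head · = x)).card = 3 := by
    intro x hx
    have h3 := hG x (by simpa using hx)
    rw [D.vertexDegree_eq, ← Set.coe_toFinset {e | D.tail e = x},
      ← Set.coe_toFinset {e | D.head e = x}, Set.encard_coe_eq_coe_finsetCard,
      Set.encard_coe_eq_coe_finsetCard, Set.toFinset_ofPred, Set.toFinset_ofPred] at h3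
    exact_mod_cast h3
  have ht := Finset.card_eq_sum_card_fiberwise (s := Finset.univ) (t := hV.toFinset) (f := D.tail)
    fun e _ => by simpa using (D.isLink e).left_mem
  have hh := Finset.card_eq_sum_card_fiberwise (s := Finset.univ) (t := hV.toFinset) (f := D.head)
    fun e _ => by simpa using (D.isLink e).right_mem
  -- Heads and tails together give 2|E| = 3|V|.
  have hsum := Finset.sum_congr rfl hdeg
  rw [Finset.sum_add_distrib, ← ht, ← hh, Finset.sum_const, smul_eq_mul,
    ← Set.ncard_eq_toFinset_card _ hV] at hsum
  rw [Nat.even_iff]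
  omega

/-! ### Bicritical graphs are irreducible -/

theorem edgeColourable_iff {k : ℕ} : G.EdgeColourable k ↔
    ∃ c : β → Fin k, ∀ x, (∀ e, ¬ G.IsLoopAt e x) ∧ InjOn c (G.incidenceSet x) := by
  have hinc (e : β) (x : α) : G.toDanglingGraph.Incident e x ↔ G.Inc e x := by
    simp [DanglingGraph.Incident, toDanglingGraph]
  refine exists_congr fun c => ⟨fun ⟨h1, h2⟩ x => ⟨fun e => h1 e x, fun e he f hf hc => ?_⟩,
    fun h => ⟨fun e x => (h x).1 e, fun e f x hef he hf hc => ?_⟩⟩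
  · by_contra hef
    exact h2 e f x hef ((hinc e x).2 he) ((hinc f x).2 hf) hc
  · exact hef ((h x).2 ((hinc e x).1 he) ((hinc f x).1 hf) hc)

/-- A subgraph of `G` that avoids `X` inherits the colourings of `G - X`. -/
theorem EdgeColourable.of_removeVerts {K : Graph α β} {X : Set α} {k : ℕ} (hK : K ≤ G)
    (hX : ∀ x ∈ K.vertexSet, x ∉ X) (h : (G.removeVerts X).EdgeColourable k) :
    K.EdgeColourable k := by
  obtain ⟨c, hc⟩ := removeVerts_edgeColourable_iff.1 h
  refine edgeColourable_iff.2 ⟨c, fun x => ⟨fun e he => ?_, fun e he f hf hef => ?_⟩⟩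
  · exact (hc x (hX x he.vertex_mem)).1 e (he.mono hK)
  · exact (hc x (hX x (Inc.vertex_mem he))).2 (Inc.mono hK he) (Inc.mono hK hf) hef

theorem EmbedsIn.encard_le {α' β' : Type*} {H : Graph α' β'} (h : G.EmbedsIn H) :
    G.vertexSet.encard ≤ H.vertexSet.encard := by
  obtain ⟨φ, -, hφ, -, hm, -⟩ := h
  exact encard_le_encard_of_injOn hm hφ

theorem IsBicritical.isIrreducible (hV : G.vertexSet.Finite) (hG : G.IsCubic)
    (h : G.IsBicritical) : G.IsIrreducible := by
  rintro k - S - - K hK hcol ⟨H, hH, hlt, hemb⟩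
  have hle : K ≤ G := hK.1.le.trans deleteEdges_le
  have hHfin : H.vertexSet.Finite := Set.finite_of_encard_le_coe
    (k := G.vertexSet.ncard) (by rw [hV.cast_ncard_eq]; exact hlt.le)
  have hKfin : K.vertexSet.Finite := hV.subset hle.vertexSet_mono
  -- Two missed vertices `u`, `v` would let `K` inherit a colouring of G - {u,v}. Parity then rules
  -- out an order of `H` that is at least |K| and less than |G|.
  have hsub : (G.vertexSet \ K.vertexSet).Subsingleton := by
    intro u hu v hv
    by_contra huv
    refine hcol (EdgeColourable.of_removeVerts hle (fun x hx => ?_) (h u hu.1 v hv.1 huv))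
    rintro (rfl | rfl)
    exacts [hu.2 hx, hv.2 hx]
  have h1 := Set.encard_le_one_iff_subsingleton.2 hsub
  have h2 := Set.encard_sdiff_add_encard_of_subset hle.vertexSet_mono
  have h3 := hemb.encard_le
  have h4 := hG.even_ncard hV
  have h5 := hH.even_ncard hHfin
  rw [← hV.cast_ncard_eq, ← hHfin.cast_ncard_eq] at hlt
  rw [← hHfin.cast_ncard_eq, ← hKfin.cast_ncard_eq] at h3
  rw [← hV.sdiff.cast_ncard_eq] at h1
  rw [← hV.cast_ncard_eq, ← hKfin.cast_ncard_eq, ← hV.sdiff.cast_ncard_eq] at h2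
  norm_cast at hlt h1 h2 h3
  rw [Nat.even_iff] at h4 h5
  omega

/-! ### Completion to a cubic graph -/

open Classical in
/-- A multiset of even cardinality, given by multiplicities, can be split into pairs. -/
theorem exists_pairing {W : Type*} [Fintype W] (d : W → ℕ) (hd : Even (∑ w, d w)) :
    ∃ (m : ℕ) (t h : Fin m → W), ∀ w,
      {i | t i = w}.encard + {i | h i = w}.encard = d w := by
  obtain ⟨m, hm⟩ := hd
  -- `P` holds `d w` labelled copies of each `w`; any bijection with two copies of `Fin m` is a
  -- pairing.
  let P := Σ w, Fin (d w)
  have e : Fin m ⊕ Fin m ≃ P := Fintype.equivOfCardEq (by simp [P, hm])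
  refine ⟨m, fun i => (e (.inl i)).1, fun i => (e (.inr i)).1, fun w => ?_⟩
  have h1 : {p : P | p.1 = w} = range (Sigma.mk w) := by
    ext ⟨v, i⟩
    constructor
    · rintro rfl
      exact ⟨i, rfl⟩
    · rintro ⟨j, hj⟩
      exact (congrArg Sigma.fst hj).symm
  have h2 : {p : P | p.1 = w} = (e ∘ Sum.inl) '' {i | (e (.inl i)).1 = w} ∪
      (e ∘ Sum.inr) '' {i | (e (.inr i)).1 = w} := by
    ext p
    obtain ⟨i | i, rfl⟩ := e.surjective p <;> simp
  have h3 : {p : P | p.1 = w}.encard = d w := by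
    rw [h1, ← image_univ, sigma_mk_injective.encard_image, encard_univ]
    simp
  rw [← h3, h2, encard_union_eq, (e.injective.comp Sum.inl_injective).encard_image,
    (e.injective.comp Sum.inr_injective).encard_image]
  rw [Set.disjoint_left]
  rintro _ ⟨i, -, rfl⟩ ⟨j, -, hj⟩
  simp at hj

/-- The graph with vertices `W` and edges `ι` joining `t i` with `h i`, with its vertices and edges
relabelled. -/
def ofEnds {W ι : Type*} (t h : ι → W) (f : W → α) {k : ι → β}
    (hk : Function.Injective k) : Graph α β where
  vertexSet := range f
  IsLink e x y := ∃ i, k i = e ∧ (f (t i) = x ∧ f (h i) = y ∨ f (t i) = y ∧ f (h i) = x)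
  isLink_symm e _ := ⟨fun x y ⟨i, hi, h⟩ => ⟨i, hi, h.symm⟩⟩
  eq_or_eq_of_isLink_of_isLink := by
    rintro e x y v w ⟨i, rfl, h1⟩ ⟨j, hj, h2⟩
    obtain rfl := hk hj
    grind
  left_mem_of_isLink := by
    rintro e x y ⟨i, rfl, ⟨rfl, -⟩ | ⟨-, rfl⟩⟩ <;> exact mem_range_self _

/-- Give each vertex as many half-edges as its degree lacks from 3 and pair them arbitrarily, which
may create loops and parallel edges. If their number is odd, one new vertex with three half-edges
repairs the parity; this is the `+ 1` in the bound. -/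
theorem exists_cubic_completion {K : Graph α β} (hV : K.vertexSet.Finite)
    (hdeg : ∀ x ∈ K.vertexSet, K.vertexDegree x ≤ 3) (hE : K.edgeSet.Finite) {n : ℕ∞}
    (hn : K.vertexSet.encard + 1 < n) : K.HasCubicCompletionBelow n := by
  classical
  have := hV.fintype
  have := hE.fintype
  obtain ⟨D⟩ := nonempty_orientation K
  let t₀ : K.edgeSet → K.vertexSet := fun e => ⟨D.tail e, (D.isLink e).left_mem⟩
  let h₀ : K.edgeSet → K.vertexSet := fun e => ⟨D.head e, (D.isLink e).right_mem⟩
  let d₀ : K.vertexSet → ℕ := fun x => {e | t₀ e = x}.ncard + {e | h₀ e = x}.ncard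
  have hd₀ (x : K.vertexSet) : {e | t₀ e = x}.encard + {e | h₀ e = x}.encard = d₀ x := by
    simp only [d₀, Nat.cast_add, (Set.toFinite _).cast_ncard_eq]
  have hd₀' (x : K.vertexSet) : d₀ x ≤ 3 := by
    have h1 := hdeg x x.2
    rw [D.vertexDegree_eq] at h1
    have h2 : {e | D.tail e = x} = {e | t₀ e = x} := by simp [t₀, Subtype.ext_iff]
    have h3 : {e | D.head e = x} = {e | h₀ e = x} := by simp [h₀, Subtype.ext_iff]
    rw [h2, h3, hd₀] at h1
    exact_mod_cast h1
  let r := (∑ x, (3 - d₀ x)) % 2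
  let d : K.vertexSet ⊕ Fin r → ℕ := Sum.elim (fun x => 3 - d₀ x) (fun _ => 3)
  obtain ⟨m, t₁, h₁, hd⟩ := exists_pairing d (by
    simp only [d, Fintype.sum_sum_type, Sum.elim_inl, Sum.elim_inr, Finset.sum_const,
      Finset.card_univ, Fintype.card_fin, smul_eq_mul, Nat.even_iff, r]
    omega)
  let t : K.edgeSet ⊕ Fin m → K.vertexSet ⊕ Fin r := Sum.elim (fun e => .inl (t₀ e)) t₁
  let h : K.edgeSet ⊕ Fin m → K.vertexSet ⊕ Fin r := Sum.elim (fun e => .inl (h₀ e)) h₁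
  have hsplit (a : K.edgeSet ⊕ Fin m → K.vertexSet ⊕ Fin r) (w : K.vertexSet ⊕ Fin r) :
      {i | a i = w}.encard = {e | a (.inl e) = w}.encard + {i | a (.inr i) = w}.encard := by
    have : {i | a i = w} =
        Sum.inl '' {e | a (.inl e) = w} ∪ Sum.inr '' {i | a (.inr i) = w} := by
      ext (i | i) <;> simp
    rw [this, encard_union_eq (by simp [Set.disjoint_left]), Sum.inl_injective.encard_image,
      Sum.inr_injective.encard_image]
  have hth (w : K.vertexSet ⊕ Fin r) : {i | t i = w}.encard + {i | h i = w}.encard = 3 := by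
    rw [hsplit t, hsplit h, add_add_add_comm]
    have h1 : {i | t (.inr i) = w}.encard + {i | h (.inr i) = w}.encard = d w := hd w
    rw [h1]
    rcases w with x | j
    · have h2 : {e | t (.inl e) = .inl x} = {e | t₀ e = x} := by simp [t]
      have h3 : {e | h (.inl e) = .inl x} = {e | h₀ e = x} := by simp [h]
      rw [h2, h3, hd₀]
      have := hd₀' x
      simp only [d, Sum.elim_inl]
      norm_cast
      omega
    · simp [t, h, d]
  obtain ⟨f, hf⟩ := exists_injective_nat (K.vertexSet ⊕ Fin r)
  obtain ⟨k, hk⟩ := exists_injective_nat (K.edgeSet ⊕ Fin m)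
  -- The value 0 outside `K` is arbitrary, as the embedding is only tested on `K`.
  refine ⟨ofEnds t h f hk, ?_, ?_, fun x => if hx : x ∈ K.vertexSet then f (.inl ⟨x, hx⟩) else 0,
    fun e => if he : e ∈ K.edgeSet then k (.inl ⟨e, he⟩) else 0, ?_, ?_, ?_, ?_⟩
  · rintro _ ⟨w, rfl⟩
    rw [vertexDegree_eq (t := f ∘ t) (h := f ∘ h) hk (fun _ _ _ => Iff.rfl)]
    simpa only [Function.comp_apply, hf.eq_iff] using hth w
  · refine lt_of_le_of_lt ?_ hn
    change (range f).encard ≤ _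
    rw [← image_univ, hf.encard_image, encard_univ, ENat.card_eq_coe_fintype_card,
      Fintype.card_sum, Fintype.card_fin, Set.encard_eq_coe_toFinset_card, Set.toFinset_card]
    have : r ≤ 1 := by omega
    norm_cast
    omega
  · intro x hx y hy hxy
    simpa [hx, hy, hf.eq_iff] using hxy
  · intro x hx y hy hxy
    simpa [hx, hy, hk.eq_iff] using hxy
  · intro x hx
    simp only [hx, dif_pos]
    exact mem_range_self _
  · intro e x y hxy
    simp only [hxy.left_mem, hxy.right_mem, hxy.edge_mem, dif_pos]
    refine ⟨_, rfl, ?_⟩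
    simpa [hf.eq_iff, t, h, t₀, h₀] using
      (D.isLink ⟨e, hxy.edge_mem⟩).eq_and_eq_or_eq_and_eq hxy

/-! ### From 7-irreducible to bicritical -/

theorem vertexDegree_mono {K : Graph α β} (hK : K ≤ G) (x : α) :
    K.vertexDegree x ≤ G.vertexDegree x :=
  add_le_add (encard_le_encard fun _ he => Inc.mono hK he)
    (encard_le_encard fun _ he => IsLoopAt.mono hK he)

theorem isComponentOf_induce {x : α} (hx : x ∈ G.vertexSet) :
    (G.induce {y | Relation.ReflTransGen G.Adj x y}).IsComponentOf G := by
  have hsub : {y | Relation.ReflTransGen G.Adj x y} ⊆ G.vertexSet := by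
    intro y hy
    rcases Relation.ReflTransGen.cases_tail hy with rfl | ⟨z, -, hz⟩
    exacts [hx, hz.right_mem]
  refine ⟨.mk' (induce_le hsub) ?_, ⟨x, .refl⟩, ?_⟩
  · rintro e y ⟨z, hyz⟩ hy
    exact ⟨y, z, hyz, hy, Relation.ReflTransGen.tail hy hyz.adj⟩
  · have hpath : ∀ y, Relation.ReflTransGen G.Adj x y → Relation.ReflTransGen
        (G.induce {y | Relation.ReflTransGen G.Adj x y}).Adj x y := by
      intro y hy
      induction hy with
      | refl => exact .refl
      | tail hy hyz ih =>
        obtain ⟨e, he⟩ := hyz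
        exact ih.tail ⟨e, he, hy, hy.tail he.adj⟩
    intro y hy z hz
    exact (Std.Symm.symm _ _ (hpath y hy)).trans (hpath z hz)

/-- A graph is colourable if all its components are. -/
theorem edgeColourable_of_components {k : ℕ} [NeZero k] (h : ∀ x ∈ G.vertexSet,
    (G.induce {y | Relation.ReflTransGen G.Adj x y}).EdgeColourable k) :
    G.EdgeColourable k := by
  classical
  let C : α → Set α := fun x => {y | Relation.ReflTransGen G.Adj x y}
  have hC {x y : α} (hxy : G.Adj x y) : C x = C y := by
    ext z
    exact ⟨fun hz => hz.head hxy.symm, fun hz => hz.head hxy⟩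
  have hcol (X : Set α) : ∃ c : β → Fin k, (G.induce X).EdgeColourable k →
      ∀ x, (∀ e, ¬ (G.induce X).IsLoopAt e x) ∧ InjOn c ((G.induce X).incidenceSet x) := by
    by_cases hX : (G.induce X).EdgeColourable k
    · obtain ⟨c, hc⟩ := edgeColourable_iff.1 hX
      exact ⟨c, fun _ => hc⟩
    · exact ⟨0, fun h => absurd h hX⟩
  choose col hcol using hcol
  refine edgeColourable_iff.2
    ⟨fun e => if he : ∃ y, G.Inc e y then col (C he.choose) e else 0, fun x => ?_⟩
  -- Both ends of an edge lie in one component, so the colour does not depend on which end was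
  -- chosen.
  have hval {e : β} (he : G.Inc e x) :
      (if he : ∃ y, G.Inc e y then col (C he.choose) e else 0) = col (C x) e := by
    have hex : ∃ y, G.Inc e y := ⟨x, he⟩
    rw [dif_pos hex]
    obtain ⟨z, hz⟩ := he
    rcases hex.choose_spec.eq_or_eq_of_isLink hz with h | h
    · rw [h]
    · rw [h, hC hz.adj]
  have hlink {e : β} {y : α} (he : G.IsLink e x y) : (G.induce (C x)).IsLink e x y :=
    ⟨he, .refl, .single he.adj⟩
  refine ⟨fun e he => (hcol _ (h x he.vertex_mem) x).1 e (hlink he), fun e he f hf hef => ?_⟩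
  simp only [hval he, hval hf] at hef
  obtain ⟨y, hy⟩ := he
  obtain ⟨z, hz⟩ := hf
  exact (hcol _ (h x hy.left_mem) x).2 ⟨y, hlink hy⟩ ⟨z, hlink hz⟩ hef

/-- Used at a single vertex: the edges at it that lack a colour receive the colours left over. -/
theorem exists_injOn_extension {I J : Set β} {k : ℕ} (hI : I.encard = k) (hJ : J ⊆ I)
    {c : β → Fin k} (hc : InjOn c J) : ∃ c' : β → Fin k, InjOn c' I ∧ EqOn c' c J := by
  classical
  have hfin : I.Finite := Set.finite_of_encard_eq_coe hI
  have := hfin.fintype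
  have hcard : Fintype.card I = (Finset.univ : Finset (Fin k)).card := by
    rw [Set.encard_eq_coe_toFinset_card, Set.toFinset_card] at hI
    rw [Finset.card_univ, Fintype.card_fin]
    exact_mod_cast hI
  obtain ⟨g, hg⟩ := Finset.exists_equiv_extend_of_card_eq hcard
    (s := Finset.univ.filter fun e : I => (e : β) ∈ J) (f := fun e => c e) (by simp) (by
      intro e he f hf hef
      exact Subtype.ext (hc (by simpa using he) (by simpa using hf) hef))
  refine ⟨fun e => if he : e ∈ I then g ⟨e, he⟩ else c e, fun e he f hf hef => ?_, fun e he => ?_⟩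
  · simp only [he, hf, dif_pos] at hef
    exact congrArg Subtype.val (g.injective (Subtype.ext hef))
  · simp only [hJ he, dif_pos]
    exact hg ⟨e, hJ he⟩ (by simpa using he)

/-- In a cubic graph, colourings can be extended to the dangling edges of `G - {u,v}`. -/
theorem removeVerts_edgeColourable_of_deleteEdges (hG : G.IsCubic) {u v : α}
    (h : (G.deleteEdges (G.incidenceSet u ∪ G.incidenceSet v)).EdgeColourable 3) :
    (G.removeVerts {u, v}).EdgeColourable 3 := by
  classical
  obtain ⟨c, hc⟩ := edgeColourable_iff.1 h
  set S := G.incidenceSet u ∪ G.incidenceSet v with hS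
  have hloop (x : α) (hx : x ∉ ({u, v} : Set α)) (e : β) : ¬ G.IsLoopAt e x := by
    intro he
    refine (hc x).1 e (deleteEdges_isLoopAt.2 ⟨he, ?_⟩)
    rintro (h | h)
    · exact hx (.inl (he.eq_of_inc h))
    · exact hx (.inr (he.eq_of_inc h))
  -- An edge of `S` has at most one end outside {u,v}, so the local extensions `c'` at different
  -- vertices cannot conflict.
  have hext (x : α) : ∃ c' : β → Fin 3, x ∉ ({u, v} : Set α) →
      InjOn c' (G.incidenceSet x) ∧ EqOn c' c (G.incidenceSet x \ S) := by
    by_cases hx : x ∈ G.vertexSet ∧ x ∉ ({u, v} : Set α)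
    · obtain ⟨c', hc'⟩ := exists_injOn_extension (J := G.incidenceSet x \ S) (c := c)
        (encard_incidenceSet_of_loopless (hG x hx.1) (hloop x hx.2)) sdiff_subset
        ((hc x).2.mono fun e he => deleteEdges_inc.2 he)
      exact ⟨c', fun _ => hc'⟩
    · refine ⟨c, fun h => ⟨fun e he => ?_, fun _ _ => rfl⟩⟩
      exact absurd ⟨Inc.vertex_mem he, h⟩ hx
  choose cx hcx using hext
  refine removeVerts_edgeColourable_iff.2
    ⟨fun e => if he : e ∈ S ∧ ∃ x ∉ ({u, v} : Set α), G.Inc e x then cx he.2.choose e else c e,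
      fun x hx => ⟨hloop x hx, ?_⟩⟩
  refine (hcx x hx).1.congr fun e he => ?_
  by_cases heS : e ∈ S
  · have hex : ∃ x ∉ ({u, v} : Set α), G.Inc e x := ⟨x, hx, he⟩
    have hxe : hex.choose = x := by
      obtain ⟨hy, hey⟩ := hex.choose_spec
      generalize hex.choose = y at hy hey
      simp only [mem_insert_iff, mem_singleton_iff, not_or] at hx hy
      rcases heS with h | h
      · exact (hey.eq_or_eq_or_eq he h).resolve_right (by tauto)
      · exact (hey.eq_or_eq_or_eq he h).resolve_right (by tauto)
    simp only [heS, hex, and_self, dif_pos, hxe]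
  · simp only [heS, false_and, dif_neg, not_false_eq_true]
    exact (hcx x hx).2 ⟨he, heS⟩

theorem IsKIrreducible.isBicritical (hV : G.vertexSet.Finite) (hE : G.edgeSet.Finite)
    (hG : G.IsCubic) (h : G.IsKIrreducible 7) : G.IsBicritical := by
  intro u hu v hv huv
  set S := G.incidenceSet u ∪ G.incidenceSet v with hS
  -- Two vertices of degree 3 meet at most six edges, whence the 7.
  have hScard : S.encard < (7 : ℕ) := by
    have h3 (x : α) (hx : x ∈ G.vertexSet) : (G.incidenceSet x).encard ≤ 3 :=
      (hG x hx) ▸ le_self_add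
    refine ((encard_union_le _ _).trans (add_le_add (h3 u hu) (h3 v hv))).trans_lt ?_
    norm_num
  have hisol {x y : α} (hx : x ∈ ({u, v} : Set α)) : ¬ (G.deleteEdges S).Adj x y := by
    rintro ⟨e, he⟩
    obtain ⟨h1, h2⟩ := deleteEdges_inc.1 he.inc_left
    rcases hx with rfl | rfl
    exacts [h2 (.inl h1), h2 (.inr h1)]
  refine removeVerts_edgeColourable_of_deleteEdges hG (edgeColourable_of_components fun x hx => ?_)
  rw [← hS] at hx ⊢
  by_contra hcol
  by_cases hxuv : x ∈ ({u, v} : Set α)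
  -- Deleting `S` isolates `u` and `v`, so their components have no edges.
  · refine hcol (edgeColourable_iff.2 ⟨0, fun y => ?_⟩)
    have hinc (e : β) : ¬ ((G.deleteEdges S).induce
        {y | Relation.ReflTransGen (G.deleteEdges S).Adj x y}).Inc e y := by
      rintro ⟨z, hz, hy, -⟩
      rcases Relation.ReflTransGen.cases_head hy with rfl | ⟨w, hw, -⟩
      exacts [hisol hxuv hz.adj, hisol hxuv hw]
    exact ⟨fun e he => hinc e he.inc, fun e he => absurd he (hinc e)⟩
  · have hK := isComponentOf_induce hx
    refine h S (union_subset (G.incidenceSet_subset_edgeSet u) (G.incidenceSet_subset_edgeSet v))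
      hScard _ hK hcol ?_
    have hle := hK.1.le.trans (deleteEdges_le (G := G) (F := S))
    set K := (G.deleteEdges S).induce {y | Relation.ReflTransGen (G.deleteEdges S).Adj x y}
    have hKfin := hV.subset hle.vertexSet_mono
    refine exists_cubic_completion hKfin
      (fun y hy => (vertexDegree_mono hle y).trans (hG y (hle.vertexSet_mono hy)).le)
      (hE.subset hle.edgeSet_mono) ?_
    -- Missing both `u` and `v` leaves room for the extra vertex: |K| + 1 ≤ |G| - 1.
    have hsub : K.vertexSet ⊆ G.vertexSet \ {u, v} := by
      refine fun y hy => ⟨hle.vertexSet_mono hy, fun hyuv => ?_⟩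
      rcases Relation.ReflTransGen.cases_tail hy with rfl | ⟨w, -, hw⟩
      exacts [hxuv hyuv, hisol hyuv hw.symm]
    have h1 := encard_le_encard hsub
    have h2 := encard_sdiff_add_encard_of_subset (pair_subset hu hv)
    rw [encard_pair huv] at h2
    rw [← h2]
    have h3 := hV.sdiff (t := {u, v})
    rw [← hKfin.cast_ncard_eq, ← h3.cast_ncard_eq] at *
    norm_cast at *
    omega

end Graph

theorem mainTheorem1 {α β : Type*} (G : Graph α β) (hG : G.IsSnark) :
    List.TFAE [G.IsBicritical, G.IsFourVertexCritical, G.IsKIrreducible 7, G.IsIrreducible] := by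
  tfae_have 1 ↔ 2 := forall₂_congr fun _ _ => forall₂_congr fun _ _ => forall_congr' fun _ =>
    Graph.removeVerts_edgeColourable_iff_identify hG.finite_vertexSet hG.finite_edgeSet hG.cubic
  tfae_have 1 → 4 := Graph.IsBicritical.isIrreducible hG.finite_vertexSet hG.cubic
  tfae_have 4 → 3 := fun h => h 7 (by norm_num)
  tfae_have 3 → 1 :=
    Graph.IsKIrreducible.isBicritical hG.finite_vertexSet hG.finite_edgeSet hG.cubic
  tfae_finish
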